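/- Let $m,n,m'\ge 0$ be integers, let $g\in\mathbb{R}^3$, and let $O_g(3)=\{O\in\mathbb{R}^{3\times 3} : O^\top O=I,\ Og=g\}$. A function $f:\mathbb{R}^{3\times m}\times\mathbb{R}^n\to\mathbb{R}^{3\times m'}$ is called $O_g(3)$-equivariant if $f(OZ,h)=O\,f(Z,h)$ for all $O\in O_g(3)$, $Z\in\mathbb{R}^{3\times m}$ and $h\in\mathbb{R}^n$. Let $[Z,g]\in\mathbb{R}^{3\times(m+1)}$ denote $Z$ with the additional column $g$, and for a map $\sigma:\mathbb{R}^{(m+1)\times(m+1)}\times\mathbb{R}^n\to\mathbb{R}^{(m+1)\times m'}$ put $$f_g(Z,h)=[Z,g]\,\sigma\big([Z,g]^\top[Z,g],\,h\big).$$ (a) For every $\sigma$, in particular for every multi-layer perceptron (MLP) $\sigma$, the function $f_g$ is $O_g(3)$-equivariant. (b) Fix a continuous activation function $\rho:\mathbb{R}\to\mathbb{R}$ that is not a polynomial. Let $\hat f:\mathbb{R}^{3\times m}\times\mathbb{R}^n\to\mathbb{R}^{3\times m'}$ be $O_g(3)$-equivariant, and let $K\subset\mathbb{R}^{3\times m}\times\mathbb{R}^n$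 be a compact set on which $\hat f$ is continuous. Then for every $\epsilon>0$ there is an MLP $\sigma$ with activation $\rho$ (finitely many, and at least one, hidden layers of finite widths, followed by an affine output layer; its inputs are the entries of the matrix argument together with those of $h$) such that $$\|\hat f(Z,h)-f_g(Z,h)\|_F<\epsilon\qquad\text{for all }(Z,h)\in K,$$ where $\|\cdot\|_F$ is the Frobenius norm. -/

import Mathlib

noncomputable section

/-- The group `O_g(3)` of orthogonal `3 × 3` matrices fixing the vector `g`. -/
def gravityGroup (g : Fin 3 → ℝ) : Subgroup (Matrix.orthogonalGroup (Fin 3) ℝ) where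
  carrier := {O | (O : Matrix (Fin 3) (Fin 3) ℝ).mulVec g = g}
  one_mem' := by simp
  mul_mem' := by
    intro A B hA hB
    simp only [Set.mem_ofPred_eq] at hA hB ⊢
    rw [Matrix.UnitaryGroup.mul_val, ← Matrix.mulVec_mulVec, hB, hA]
  inv_mem' := by
    intro A hA
    simp only [Set.mem_ofPred_eq] at hA ⊢
    have h : ((A⁻¹ * A : Matrix.orthogonalGroup (Fin 3) ℝ) : Matrix (Fin 3) (Fin 3) ℝ).mulVec g
        = g := by
      rw [inv_mul_cancel, Matrix.UnitaryGroup.one_val, Matrix.one_mulVec]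
    rwa [Matrix.UnitaryGroup.mul_val, ← Matrix.mulVec_mulVec, hA] at h

/-- A function `f : ℝ^{3×m} × ℝ^n → ℝ^{3×m'}` is `O_g(3)`-equivariant if
`f (O Z, h) = O f (Z, h)` for all `O ∈ O_g(3)`, `Z` and `h`. -/
def IsSubequivariant {m n m' : ℕ} (g : Fin 3 → ℝ)
    (f : Matrix (Fin 3) (Fin m) ℝ × (Fin n → ℝ) → Matrix (Fin 3) (Fin m') ℝ) : Prop :=
  ∀ O ∈ gravityGroup g, ∀ (Z : Matrix (Fin 3) (Fin m) ℝ) (h : Fin n → ℝ),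
    f ((O : Matrix (Fin 3) (Fin 3) ℝ) * Z, h) = (O : Matrix (Fin 3) (Fin 3) ℝ) * f (Z, h)

/-- The matrix `[Z, g]`: the columns of `Z`, followed by the column `g`.
Its `m + 1` columns are indexed by `Fin m ⊕ Unit`. -/
def augment {m : ℕ} (g : Fin 3 → ℝ) (Z : Matrix (Fin 3) (Fin m) ℝ) :
    Matrix (Fin 3) (Fin m ⊕ Unit) ℝ :=
  Matrix.fromCols Z (Matrix.replicateCol Unit g)

/-- The function `f_g (Z, h) = [Z, g] · σ([Z, g]ᵀ [Z, g], h)`. -/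
def subequivariantMap {m n m' : ℕ} (g : Fin 3 → ℝ)
    (σ : Matrix (Fin m ⊕ Unit) (Fin m ⊕ Unit) ℝ → (Fin n → ℝ) →
      Matrix (Fin m ⊕ Unit) (Fin m') ℝ)
    (p : Matrix (Fin 3) (Fin m) ℝ × (Fin n → ℝ)) : Matrix (Fin 3) (Fin m') ℝ :=
  augment g p.1 * σ ((augment g p.1).transpose * augment g p.1) p.2

/-- The parameters (weight matrices and bias vectors) of a multi-layer perceptron with inputs
indexed by `α` and outputs indexed by `β`: one or more hidden layers of arbitrary finite widths,
followed by an affine output layer. The layers are listed from the input side. -/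
inductive MLP (β : Type) : Type → Type 1
  /-- The last hidden layer (weights `W`, biases `b`) and the affine output layer (`U`, `c`). -/
  | last {α : Type} {k : ℕ} (W : Matrix (Fin k) α ℝ) (b : Fin k → ℝ)
      (U : Matrix β (Fin k) ℝ) (c : β → ℝ) : MLP β α
  /-- A hidden layer (weights `W`, biases `b`) that feeds the perceptron `N`. -/
  | layer {α : Type} {k : ℕ} (W : Matrix (Fin k) α ℝ) (b : Fin k → ℝ)
      (N : MLP β (Fin k)) : MLP β α

/-- The function computed by a multi-layer perceptron whose hidden units have activation `ρ`. -/
def MLP.eval (ρ : ℝ → ℝ) {β : Type} : {α : Type} → [Fintype α] → MLP β α → (α → ℝ) → (β → ℝ)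
  | _, _, .last W b U c, x => U.mulVec (fun i => ρ (W.mulVec x i + b i)) + c
  | _, _, .layer W b N, x => N.eval ρ (fun i => ρ (W.mulVec x i + b i))

/-- A perceptron read as a map `(G, h) ↦ V`: the entries of the matrix `G`, concatenated with
the vector `h`, are its inputs, and the entries of the matrix `V` are its outputs. -/
def MLP.matrixMap (ρ : ℝ → ℝ) {κ : Type} [Fintype κ] {n m' : ℕ}
    (N : MLP (κ × Fin m') ((κ × κ) ⊕ Fin n)) (G : Matrix κ κ ℝ) (h : Fin n → ℝ) :
    Matrix κ (Fin m') ℝ :=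
  Matrix.of fun i j => N.eval ρ (Sum.elim (fun q => G q.1 q.2) h) (i, j)

section

attribute [local instance] Matrix.frobeniusNormedAddCommGroup

/-- The Frobenius norm of a matrix. -/
def frobeniusNorm {k l : ℕ} (A : Matrix (Fin k) (Fin l) ℝ) : ℝ := ‖A‖

end

end

/-!
If `O` fixes the columns of `A = [Z, g]`, then equivariance says that it fixes the columns of
`f (Z, h)`; taking for `O` the reflection in the span of the columns of `A` gives
`f (Z, h) = A * S` for some `S`. Two matrices with the same Gram matrix differ by an orthogonal
factor, so by equivariance the same `S` serves for all points with the same invariants `(AᵀA, h)`.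
That `A * S` is within `ε` of `f (Z, h)` is an open and convex condition on `S`, so a partition of
unity on the compact set of invariants makes `S` a continuous function of the invariants, and a
sufficiently close perceptron still satisfies the condition.

Density of perceptrons with one hidden layer: let `V` be the closed span of the functions
`ρ ∘ (s • u + b)`, with `u` linear. Mollifying `ρ` and differentiating in `s` stays in `V` and gives
`u ^ k ∈ V`, unless all mollifications of `ρ`, hence `ρ` itself, are polynomials. So `V` contains
every `exp u`, and the `exp u` span an algebra that separates points.
-/

open MeasureTheory Topology Filter
open scoped ContDiff Convolution Matrix

/-- The real polynomial functions of degree less than `k`, as functions rather than formal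
polynomials, so that limits can be taken in the product topology of `ℝ → ℝ`. -/
def polynomialFunctionsLT (k : ℕ) : Submodule ℝ (ℝ → ℝ) :=
  Submodule.span ℝ (Set.range fun (i : Fin k) (t : ℝ) => t ^ (i : ℕ))

theorem pow_mem_polynomialFunctionsLT {i k : ℕ} (hik : i < k) :
    (fun t : ℝ => t ^ i) ∈ polynomialFunctionsLT k :=
  Submodule.subset_span ⟨⟨i, hik⟩, rfl⟩

theorem isClosed_polynomialFunctionsLT (k : ℕ) :
    IsClosed (polynomialFunctionsLT k : Set (ℝ → ℝ)) :=
  have : FiniteDimensional ℝ (polynomialFunctionsLT k) :=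
    FiniteDimensional.span_of_finite ℝ (Set.finite_range _)
  Submodule.closed_of_finiteDimensional _

theorem exists_eval_eq_of_mem_polynomialFunctionsLT {k : ℕ} {f : ℝ → ℝ}
    (hf : f ∈ polynomialFunctionsLT k) : ∃ P : Polynomial ℝ, ∀ t, f t = P.eval t := by
  obtain ⟨a, rfl⟩ := (Submodule.mem_span_range_iff_exists_fun ℝ).1 hf
  refine ⟨∑ i : Fin k, Polynomial.monomial i (a i), fun t => ?_⟩
  simp [Polynomial.eval_finsetSum]

theorem exists_antideriv_mem_polynomialFunctionsLT {k : ℕ} {f : ℝ → ℝ}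
    (hf : f ∈ polynomialFunctionsLT k) :
    ∃ F ∈ polynomialFunctionsLT (k + 1), ∀ t, HasDerivAt F (f t) t := by
  induction hf using Submodule.span_induction with
  | mem f hf =>
    obtain ⟨i, rfl⟩ := hf
    refine ⟨_, Submodule.smul_mem _ ((i : ℝ) + 1)⁻¹
      (pow_mem_polynomialFunctionsLT (Nat.succ_lt_succ i.2)), fun t => ?_⟩
    refine ((hasDerivAt_pow (i + 1 : ℕ) t).const_smul ((i : ℝ) + 1)⁻¹).congr_deriv ?_
    simp [Nat.cast_add_one_ne_zero]
  | zero => exact ⟨0, Submodule.zero_mem _, fun t => hasDerivAt_const t 0⟩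
  | add f g _ _ ihf ihg =>
    obtain ⟨F, hF, hFf⟩ := ihf
    obtain ⟨G, hG, hGg⟩ := ihg
    exact ⟨F + G, Submodule.add_mem _ hF hG, fun t => (hFf t).add (hGg t)⟩
  | smul a f _ ih =>
    obtain ⟨F, hF, hFf⟩ := ih
    exact ⟨a • F, Submodule.smul_mem _ a hF, fun t => (hFf t).const_smul a⟩

theorem mem_polynomialFunctionsLT_of_iteratedDeriv_eq_zero {k : ℕ} {f : ℝ → ℝ}
    (hf : ContDiff ℝ k f) (h : ∀ t, iteratedDeriv k f t = 0) : f ∈ polynomialFunctionsLT k := by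
  induction k generalizing f with
  | zero =>
    have : f = 0 := by simpa [funext_iff] using h
    exact this ▸ Submodule.zero_mem _
  | succ k ih =>
    obtain ⟨hfd, -, hf'⟩ := (contDiff_succ_iff_deriv (n := k)).1 (mod_cast hf)
    obtain ⟨F, hF, hFf⟩ := exists_antideriv_mem_polynomialFunctionsLT
      (ih hf' (by simpa only [iteratedDeriv_succ'] using h))
    have hderiv : ∀ t, HasDerivAt (f - F) 0 t := fun t => by
      simpa using (hfd t).hasDerivAt.sub (hFf t)
    have hconst : f = F + (f - F) 0 • fun t => t ^ 0 := by
      ext t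
      have := is_const_of_deriv_eq_zero (fun t => (hderiv t).differentiableAt)
        (fun t => (hderiv t).deriv) t 0
      simp only [Pi.sub_apply, Pi.add_apply, Pi.smul_apply, pow_zero, smul_eq_mul] at this ⊢
      linarith
    rw [hconst]
    exact Submodule.add_mem _ hF
      (Submodule.smul_mem _ _ (pow_mem_polynomialFunctionsLT k.succ_pos))

section ClosedSubmodule

variable {E : Type*} [NormedAddCommGroup E] [NormedSpace ℝ E] {V : Submodule ℝ E}

theorem hasDerivAt_mem_of_isClosed (hV : IsClosed (V : Set E)) {c : ℝ → E} (hc : ∀ s, c s ∈ V)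
    {c' : E} {s : ℝ} (h : HasDerivAt c c' s) : c' ∈ V :=
  hV.mem_of_tendsto h.tendsto_slope
    (Eventually.of_forall fun _ => V.smul_mem _ (V.sub_mem (hc _) (hc _)))

theorem integral_mem_of_isClosed [CompleteSpace E] (hV : IsClosed (V : Set E)) {Ω : Type*}
    [MeasurableSpace Ω] {μ : Measure Ω} {c : Ω → E} (hc : ∀ a, c a ∈ V) : ∫ a, c a ∂μ ∈ V := by
  by_cases hint : Integrable c μ
  · have : IsClosed (V.toAddSubgroup : Set E) := hV
    have hmk : V.mkQL (∫ a, c a ∂μ) = 0 := by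
      rw [← V.mkQL.integral_comp_comm hint]
      simp [(Submodule.Quotient.mk_eq_zero V).2 (hc _)]
    simpa using hmk
  · exact integral_undef hint ▸ V.zero_mem

end ClosedSubmodule

section ContinuousFunctions

variable {X : Type*} [TopologicalSpace X] [CompactSpace X]

theorem hasDerivAt_continuousMap_of_apply {E : Type*} [NormedAddCommGroup E] [NormedSpace ℝ E]
    [CompleteSpace E] {c c' : ℝ → C(X, E)} (hc' : Continuous c')
    (h : ∀ x s, HasDerivAt (fun τ => c τ x) (c' s x) s) (s : ℝ) : HasDerivAt c (c' s) s := by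
  have hint : c = fun σ => c 0 + ∫ τ in (0 : ℝ)..σ, c' τ := by
    ext σ x
    have heval := (ContinuousMap.evalCLM ℝ x).intervalIntegral_comp_comm
      (hc'.intervalIntegrable (μ := volume) 0 σ)
    have hftc := intervalIntegral.integral_eq_sub_of_hasDerivAt (fun τ _ => h x τ)
      (((ContinuousMap.evalCLM ℝ x).continuous.comp hc').intervalIntegrable 0 σ)
    exact (add_eq_of_eq_sub' (heval.symm.trans hftc)).symm
  rw [hint]
  exact ((hc'.integral_hasStrictDerivAt 0 s).hasDerivAt).const_add (c 0)

theorem hasDerivAt_mul_comp_smul_add {f f' : C(ℝ, ℝ)} (hf : ∀ t, HasDerivAt f (f' t) t)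
    (w u v : C(X, ℝ)) (s : ℝ) :
    HasDerivAt (fun s : ℝ => w * f.comp (s • u + v)) (w * u * f'.comp (s • u + v)) s := by
  refine hasDerivAt_continuousMap_of_apply (c' := fun s => w * u * f'.comp (s • u + v)) ?_
    (fun x s => ?_) s
  · have := ContinuousMap.continuous_postcomp (X := X) f'
    fun_prop
  · have hlin : HasDerivAt (fun s => s * u x + v x) (u x) s := by
      simpa using ((hasDerivAt_id s).mul_const (u x)).add_const (v x)
    refine (((hf _).comp s hlin).const_mul (w x)).congr_deriv ?_
    simp only [ContinuousMap.mul_apply, ContinuousMap.comp_apply, ContinuousMap.add_apply,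
      ContinuousMap.smul_apply, smul_eq_mul]
    ring

variable {V : Submodule ℝ C(X, ℝ)}

theorem pow_mul_comp_mem_of_hasDerivAt (hV : IsClosed (V : Set C(X, ℝ))) {f : ℕ → C(ℝ, ℝ)}
    (hf : ∀ k t, HasDerivAt (f k) (f (k + 1) t) t) {u v : C(X, ℝ)}
    (h : ∀ s : ℝ, (f 0).comp (s • u + v) ∈ V) (k : ℕ) (s : ℝ) :
    u ^ k * (f k).comp (s • u + v) ∈ V := by
  induction k generalizing s with
  | zero => simpa using h s
  | succ k ih =>
    rw [pow_succ]
    exact hasDerivAt_mem_of_isClosed hV ih (hasDerivAt_mul_comp_smul_add (hf k) (u ^ k) u v s)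

theorem comp_mem_of_eq_convolution (hV : IsClosed (V : Set C(X, ℝ))) {φ : ℝ → ℝ}
    (hφ : Continuous φ) (hφs : HasCompactSupport φ) {ρ f : C(ℝ, ℝ)}
    (hf : ⇑f = φ ⋆[ContinuousLinearMap.lsmul ℝ ℝ] ρ) {v : C(X, ℝ)}
    (h : ∀ τ : ℝ, ρ.comp (v - τ • 1) ∈ V) : f.comp v ∈ V := by
  have hcont : Continuous fun τ : ℝ => φ τ • ρ.comp (v - τ • 1) := by
    have := ContinuousMap.continuous_postcomp (X := X) ρ
    fun_prop
  have hint : f.comp v = ∫ τ, φ τ • ρ.comp (v - τ • 1) := by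
    ext x
    have heval := (ContinuousMap.evalCLM ℝ x).integral_comp_comm
      (hcont.integrable_of_hasCompactSupport hφs.smul_right (μ := volume))
    refine Eq.trans ?_ heval
    simp [hf, convolution_def, ContinuousMap.evalCLM]
  rw [hint]
  exact integral_mem_of_isClosed hV fun τ => V.smul_mem _ (h τ)

theorem pow_mem_of_iteratedDeriv_ne_zero (hV : IsClosed (V : Set C(X, ℝ))) {f : C(ℝ, ℝ)}
    (hf : ContDiff ℝ ∞ f) {u : C(X, ℝ)} (h : ∀ s b : ℝ, f.comp (s • u + b • 1) ∈ V) {k : ℕ} {b : ℝ}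
    (hb : iteratedDeriv k f b ≠ 0) : u ^ k ∈ V := by
  let D : ℕ → C(ℝ, ℝ) := fun i =>
    ⟨iteratedDeriv i f, hf.continuous_iteratedDeriv i (mod_cast le_top)⟩
  have hD : ∀ i t, HasDerivAt (D i) (D (i + 1) t) t := fun i t => by
    simpa only [D, ContinuousMap.coe_mk, iteratedDeriv_succ] using
      (hf.differentiable_iteratedDeriv i (mod_cast ENat.natCast_lt_top i) t).hasDerivAt
  have hD0 : D 0 = f := by ext; simp [D]
  have hmem := pow_mul_comp_mem_of_hasDerivAt hV hD (v := b • 1) (fun s => hD0 ▸ h s b) k 0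
  have hconst : u ^ k * (D k).comp ((0 : ℝ) • u + b • 1) = iteratedDeriv k f b • u ^ k := by
    ext x
    simp [D, mul_comm]
  exact (V.smul_mem_iff hb).1 (hconst ▸ hmem)

end ContinuousFunctions

theorem mem_of_forall_normed_convolution_mem {S : Set (ℝ → ℝ)} (hS : IsClosed S) {ρ : ℝ → ℝ}
    (hρ : Continuous ρ) (h : ∀ φ : ContDiffBump (0 : ℝ),
      (φ.normed volume ⋆[ContinuousLinearMap.lsmul ℝ ℝ] ρ) ∈ S) : ρ ∈ S := by
  let φ : ℕ → ContDiffBump (0 : ℝ) := fun n =>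
    ⟨1 / ((n : ℝ) + 1), 2 / ((n : ℝ) + 1), by positivity, by gcongr; norm_num⟩
  have hφ : Tendsto (fun n => (φ n).rOut) atTop (𝓝 0) := by
    have := (tendsto_one_div_add_atTop_nhds_zero_nat (𝕜 := ℝ)).const_mul 2
    simpa only [φ, mul_one_div, mul_zero] using this
  exact hS.mem_of_tendsto
    (tendsto_pi_nhds.2 fun t => ContDiffBump.convolution_tendsto_right_of_continuous hφ hρ t)
    (Eventually.of_forall fun n => h (φ n))

section Density

variable {X : Type*} [TopologicalSpace X] [CompactSpace X] {V : Submodule ℝ C(X, ℝ)}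

theorem pow_mem_of_comp_mem (hV : IsClosed (V : Set C(X, ℝ))) {ρ : C(ℝ, ℝ)}
    (hρ : ¬ ∃ P : Polynomial ℝ, ∀ t : ℝ, ρ t = P.eval t) {u : C(X, ℝ)}
    (h : ∀ s b : ℝ, ρ.comp (s • u + b • 1) ∈ V) (k : ℕ) : u ^ k ∈ V := by
  by_contra hk
  -- As `u ^ k ∉ V`, the `k`-th derivative of each mollification of `ρ` must vanish identically.
  refine hρ (exists_eval_eq_of_mem_polynomialFunctionsLT (k := k) ?_)
  refine mem_of_forall_normed_convolution_mem (isClosed_polynomialFunctionsLT k) ρ.continuous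
    fun φ => ?_
  have hsmooth : ContDiff ℝ ∞ (φ.normed volume ⋆[ContinuousLinearMap.lsmul ℝ ℝ] ρ) :=
    φ.hasCompactSupport_normed.contDiff_convolution_left _ φ.contDiff_normed
      ρ.continuous.locallyIntegrable
  let f : C(ℝ, ℝ) := ⟨_, hsmooth.continuous⟩
  have hf : ∀ s b : ℝ, f.comp (s • u + b • 1) ∈ V := fun s b =>
    comp_mem_of_eq_convolution hV φ.continuous_normed φ.hasCompactSupport_normed rfl fun τ => by
      simpa only [add_sub_assoc, ← sub_smul] using h s (b - τ)
  refine mem_polynomialFunctionsLT_of_iteratedDeriv_eq_zero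
    (hsmooth.of_le (mod_cast le_top)) fun b => ?_
  by_contra hb
  exact hk (pow_mem_of_iteratedDeriv_ne_zero (f := f) hV hsmooth hf hb)

theorem exp_mem_of_pow_mem {A : Type*} [NormedRing A] [NormedAlgebra ℝ A] [CompleteSpace A]
    {V : Submodule ℝ A} (hV : IsClosed (V : Set A)) {u : A} (h : ∀ k, u ^ k ∈ V) :
    NormedSpace.exp u ∈ V :=
  hV.mem_of_tendsto (NormedSpace.exp_series_hasSum_exp' (𝕂 := ℝ) u)
    (Eventually.of_forall fun _ => V.sum_mem fun k _ => V.smul_mem _ (h k))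

theorem topologicalClosure_span_exp_image (L : AddSubmonoid C(X, ℝ))
    (hL : Set.SeparatesPoints ((fun u : C(X, ℝ) => (u : X → ℝ)) '' L)) :
    (Submodule.span ℝ (NormedSpace.exp '' (L : Set C(X, ℝ)))).topologicalClosure = ⊤ := by
  let M : Submonoid C(X, ℝ) :=
    { carrier := NormedSpace.exp '' L
      one_mem' := ⟨0, L.zero_mem, NormedSpace.exp_zero⟩
      mul_mem' := by
        rintro _ _ ⟨u, hu, rfl⟩ ⟨v, hv, rfl⟩
        exact ⟨u + v, L.add_mem hu hv, NormedSpace.exp_add⟩ }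
  have hspan : Submodule.span ℝ (M : Set C(X, ℝ))
      = Subalgebra.toSubmodule (Algebra.adjoin ℝ (M : Set C(X, ℝ))) := by
    rw [Algebra.adjoin_eq_span, Submonoid.closure_eq]
  have hdense : (Algebra.adjoin ℝ (M : Set C(X, ℝ))).topologicalClosure = ⊤ := by
    refine ContinuousMap.subalgebra_topologicalClosure_eq_top_of_separatesPoints _ fun x y hxy => ?_
    obtain ⟨_, ⟨u, hu, rfl⟩, huxy⟩ := hL hxy
    refine ⟨_, ⟨_, Algebra.subset_adjoin ⟨u, hu, rfl⟩, rfl⟩, ?_⟩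
    simpa [NormedSpace.exp_continuousMap_eq, ← Real.exp_eq_exp_ℝ] using huxy
  rw [← Submodule.dense_iff_topologicalClosure_eq_top]
  change Dense ((Submodule.span ℝ (M : Set C(X, ℝ)) : Submodule ℝ C(X, ℝ)) : Set C(X, ℝ))
  rw [hspan]
  exact dense_iff_closure_eq.2 (congrArg SetLike.coe hdense)

theorem topologicalClosure_span_comp_image {ρ : C(ℝ, ℝ)}
    (hρ : ¬ ∃ P : Polynomial ℝ, ∀ t : ℝ, ρ t = P.eval t) (L : Submodule ℝ C(X, ℝ)) (h1 : 1 ∈ L)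
    (hL : Set.SeparatesPoints ((fun u : C(X, ℝ) => (u : X → ℝ)) '' L)) :
    (Submodule.span ℝ (ρ.comp '' (L : Set C(X, ℝ)))).topologicalClosure = ⊤ := by
  rw [eq_top_iff, ← topologicalClosure_span_exp_image L.toAddSubmonoid hL]
  refine Submodule.topologicalClosure_minimal _ (Submodule.span_le.2 ?_)
    (Submodule.isClosed_topologicalClosure _)
  rintro _ ⟨u, hu, rfl⟩
  have hclosed := Submodule.isClosed_topologicalClosure
    (Submodule.span ℝ (ρ.comp '' (L : Set C(X, ℝ))))
  exact exp_mem_of_pow_mem hclosed (pow_mem_of_comp_mem hclosed hρ fun s b =>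
    Submodule.le_topologicalClosure _
      (Submodule.subset_span ⟨_, L.add_mem (L.smul_mem s hu) (L.smul_mem b h1), rfl⟩))

end Density

section Perceptrons

variable {α β : Type} [Fintype α]

theorem MLP.exists_eval_eq_sum [Finite β] (ρ : ℝ → ℝ) (c : β → ((α → ℝ) × ℝ) →₀ ℝ) :
    ∃ N : MLP β α, ∀ x i, N.eval ρ x i = (c i).sum fun q a => a * ρ (q.1 ⬝ᵥ x + q.2) := by
  classical
  have := Fintype.ofFinite β
  let T : Finset ((α → ℝ) × ℝ) := Finset.univ.biUnion fun i => (c i).support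
  let τ : T ≃ Fin T.card := T.equivFin
  refine ⟨.last (Matrix.of fun j => (τ.symm j).1.1) (fun j => (τ.symm j).1.2)
    (Matrix.of fun i j => c i (τ.symm j).1) 0, fun x i => ?_⟩
  have hsub : (c i).support ⊆ T :=
    Finset.subset_biUnion_of_mem (fun i => (c i).support) (Finset.mem_univ i)
  rw [Finsupp.sum_of_support_subset _ hsub _ (by simp), ← Finset.sum_coe_sort, ← τ.symm.sum_comp]
  simp [MLP.eval, Matrix.mulVec, dotProduct]

/-- The affine functions `y ↦ w ⬝ᵥ y + b` on a set `Y`, as a linear map in the parameters `(w, b)`;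
these are the possible inputs to the activation of a hidden unit. -/
def affineFunction (Y : Set (α → ℝ)) : (α → ℝ) × ℝ →ₗ[ℝ] C(Y, ℝ) where
  toFun q := ⟨fun y => q.1 ⬝ᵥ y.1 + q.2,
    (continuous_const.dotProduct continuous_subtype_val).add continuous_const⟩
  map_add' p q := by ext y; simp [add_dotProduct, add_add_add_comm]
  map_smul' a q := by ext y; simp [mul_add]

theorem separatesPoints_range_affineFunction (Y : Set (α → ℝ)) :
    Set.SeparatesPoints
      ((fun u : C(Y, ℝ) => (u : Y → ℝ)) '' (LinearMap.range (affineFunction Y))) := by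
  classical
  intro x y hxy
  obtain ⟨i, hi⟩ := Function.ne_iff.1 (Subtype.coe_ne_coe.2 hxy)
  exact ⟨_, ⟨_, ⟨(Pi.single i 1, 0), rfl⟩, rfl⟩, by simpa [affineFunction] using hi⟩

theorem exists_finsupp_sum_activation_dist_lt {Y : Set (α → ℝ)} [CompactSpace Y] {ρ : ℝ → ℝ}
    (hc : Continuous ρ) (hρ : ¬ ∃ P : Polynomial ℝ, ∀ t : ℝ, ρ t = P.eval t) (σ : C(Y, ℝ))
    {δ : ℝ} (hδ : 0 < δ) : ∃ c : ((α → ℝ) × ℝ) →₀ ℝ, ∀ y : Y,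
      dist (σ y) (c.sum fun q a => a * ρ (q.1 ⬝ᵥ (y : α → ℝ) + q.2)) < δ := by
  let ρ' : C(ℝ, ℝ) := ⟨ρ, hc⟩
  have h1 : (1 : C(Y, ℝ)) ∈ LinearMap.range (affineFunction Y) :=
    ⟨(0, 1), by ext; simp [affineFunction]⟩
  have hσ : σ ∈ (Submodule.span ℝ
      (ρ'.comp '' (LinearMap.range (affineFunction Y) : Set C(Y, ℝ)))).topologicalClosure := by
    rw [topologicalClosure_span_comp_image (ρ := ρ') hρ _ h1
      (separatesPoints_range_affineFunction Y)]
    trivial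
  obtain ⟨_, hmem, hdist⟩ := Metric.mem_closure_iff.1 hσ δ hδ
  rw [LinearMap.coe_range, ← Set.range_comp] at hmem
  obtain ⟨c, rfl⟩ := Finsupp.mem_span_range_iff_exists_finsupp.1 hmem
  refine ⟨c, fun y => ?_⟩
  simpa [affineFunction, ρ', Finsupp.sum, ContinuousMap.sum_apply] using
    (ContinuousMap.dist_lt_iff hδ).1 hdist y

theorem MLP.exists_forall_dist_eval_lt [Fintype β] {ρ : ℝ → ℝ} (hc : Continuous ρ)
    (hρ : ¬ ∃ P : Polynomial ℝ, ∀ t : ℝ, ρ t = P.eval t) {Y : Set (α → ℝ)} (hY : IsCompact Y)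
    (σ : C(Y, β → ℝ)) {δ : ℝ} (hδ : 0 < δ) :
    ∃ N : MLP β α, ∀ y : Y, dist (σ y) (N.eval ρ y) < δ := by
  have : CompactSpace Y := isCompact_iff_compactSpace.1 hY
  have hcoord : ∀ i, ∃ c : ((α → ℝ) × ℝ) →₀ ℝ, ∀ y : Y,
      dist (σ y i) (c.sum fun q a => a * ρ (q.1 ⬝ᵥ (y : α → ℝ) + q.2)) < δ := fun i =>
    exists_finsupp_sum_activation_dist_lt hc hρ ⟨fun y => σ y i, by fun_prop⟩ hδ
  choose c hcσ using hcoord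
  obtain ⟨N, hN⟩ := MLP.exists_eval_eq_sum ρ c
  exact ⟨N, fun y => (dist_pi_lt_iff hδ).2 fun i => by simpa only [hN] using hcσ i y⟩

end Perceptrons

section Selection

theorem exists_continuous_forall_mem_convex_of_fiber {X Y E : Type*} [TopologicalSpace X]
    [CompactSpace X] [TopologicalSpace Y] [T2Space Y] [ParacompactSpace Y] [AddCommGroup E]
    [Module ℝ E] [TopologicalSpace E] [IsTopologicalAddGroup E] [ContinuousSMul ℝ E]
    {p : X → Y} (hp : Continuous p) {t : X → Set E} (ht : ∀ x, Convex ℝ (t x))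
    (h : ∀ y, ∃ v, ∀ x, p x = y → ∀ᶠ x' in 𝓝 x, v ∈ t x') :
    ∃ σ : C(Y, E), ∀ x, σ (p x) ∈ t x := by
  obtain ⟨σ, hσ⟩ := exists_continuous_forall_mem_convex_of_local_const
    (t := fun y => ⋂ x ∈ p ⁻¹' {y}, t x) (fun y => convex_iInter₂ fun x _ => ht x) fun y => by
      obtain ⟨v, hv⟩ := h y
      refine ⟨v, ?_⟩
      filter_upwards [hp.isClosedMap.eventually_nhds_fiber y hv] with y' hy'
      exact Set.mem_iInter₂.2 hy'
  exact ⟨σ, fun x => Set.mem_iInter₂.1 (hσ (p x)) x rfl⟩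

theorem MLP.exists_forall_mem_of_isOpen {α β : Type} [Fintype α] [Finite β] {ρ : ℝ → ℝ}
    (hc : Continuous ρ) (hρ : ¬ ∃ P : Polynomial ℝ, ∀ t : ℝ, ρ t = P.eval t) {X : Type*}
    [TopologicalSpace X] [CompactSpace X] {p : X → α → ℝ} (hp : Continuous p)
    {U : Set (X × (β → ℝ))} (hU : IsOpen U) (hconv : ∀ x, Convex ℝ {v | (x, v) ∈ U})
    (h : ∀ y, ∃ v, ∀ x, p x = y → (x, v) ∈ U) :
    ∃ N : MLP β α, ∀ x, (x, N.eval ρ (p x)) ∈ U := by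
  have := Fintype.ofFinite β
  obtain ⟨σ, hσ⟩ := exists_continuous_forall_mem_convex_of_fiber hp hconv fun y =>
    (h y).imp fun v hv x hx =>
      (Continuous.prodMk_left v).continuousAt.eventually_mem (hU.mem_nhds (hv x hx))
  have hopen : IsOpen {q : (β → ℝ) × X | (q.2, σ (p q.2) + q.1) ∈ U} := hU.preimage (by fun_prop)
  have htube : ∀ᶠ w : β → ℝ in 𝓝 0, ∀ x ∈ Set.univ, (x, σ (p x) + w) ∈ U :=
    isCompact_univ.eventually_forall_of_forall_eventually fun x _ =>
      hopen.mem_nhds (by simpa using hσ x)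
  obtain ⟨δ, hδ, hball⟩ := Metric.eventually_nhds_iff.1 htube
  obtain ⟨N, hN⟩ := MLP.exists_forall_dist_eval_lt hc hρ (isCompact_range hp)
    (σ.restrict (Set.range p)) hδ
  refine ⟨N, fun x => ?_⟩
  have hdist : dist (N.eval ρ (p x) - σ (p x)) 0 < δ := by
    simpa [dist_eq_norm, norm_sub_rev] using hN ⟨p x, x, rfl⟩
  simpa using hball hdist x trivial

end Selection

section OrthogonalMatrices

theorem exists_linearIsometry_apply_eq {V E : Type*} [AddCommGroup V] [Module ℝ V]
    [NormedAddCommGroup E] [InnerProductSpace ℝ E] [FiniteDimensional ℝ E] {a b : V →ₗ[ℝ] E}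
    (h : ∀ x, ‖a x‖ = ‖b x‖) : ∃ L : E →ₗᵢ[ℝ] E, ∀ x, L (a x) = b x := by
  obtain ⟨r, hr⟩ := a.rangeRestrict.exists_rightInverse_of_surjective a.range_rangeRestrict
  have har : ∀ y, a (r y) = y := fun y => congrArg Subtype.val (LinearMap.congr_fun hr y)
  let L : LinearMap.range a →ₗᵢ[ℝ] E := ⟨b ∘ₗ r, fun y => by
    rw [LinearMap.comp_apply, ← h, har, Submodule.coe_norm]⟩
  refine ⟨L.extend, fun x => ?_⟩
  calc L.extend (a x) = b (r ⟨a x, x, rfl⟩) := L.extend_apply ⟨a x, x, rfl⟩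
    _ = b x := by
      rw [← sub_eq_zero, ← map_sub, ← norm_eq_zero, ← h, map_sub, har, sub_self, norm_zero]

variable {d κ ν : Type*} [Fintype d] [DecidableEq d]

theorem exists_orthogonalGroup_toEuclideanLin_eq
    (L : EuclideanSpace ℝ d →ₗᵢ[ℝ] EuclideanSpace ℝ d) :
    ∃ O : Matrix.orthogonalGroup d ℝ, Matrix.toEuclideanLin (O : Matrix d d ℝ) = L.toLinearMap := by
  let b := EuclideanSpace.basisFun d ℝ
  let e := L.toLinearIsometryEquiv rfl
  refine ⟨⟨_, e.toMatrix_mem_unitaryGroup b b⟩, ?_⟩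
  rw [Matrix.toEuclideanLin_eq_toLin_orthonormal]
  exact Matrix.toLin_toMatrix _ _ _

theorem exists_orthogonalGroup_mul_eq_of_gram_eq [Finite κ] {A B : Matrix d κ ℝ}
    (h : Aᵀ * A = Bᵀ * B) : ∃ O : Matrix.orthogonalGroup d ℝ, (O : Matrix d d ℝ) * A = B := by
  classical
  have := Fintype.ofFinite κ
  have hinner : ∀ (C : Matrix d κ ℝ) (x), ‖Matrix.toEuclideanLin C x‖ ^ 2
      = inner ℝ x (Matrix.toEuclideanLin (Cᵀ * C) x) := fun C x => by
    rw [Matrix.toLpLin_mul_same, ← Matrix.conjTranspose_eq_transpose_of_trivial,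
      Matrix.toEuclideanLin_conjTranspose_eq_adjoint, LinearMap.comp_apply,
      LinearMap.adjoint_inner_right, real_inner_self_eq_norm_sq]
  obtain ⟨L, hL⟩ := exists_linearIsometry_apply_eq fun x =>
    (sq_eq_sq₀ (norm_nonneg _) (norm_nonneg _)).1 ((hinner A x).trans (h ▸ (hinner B x).symm))
  obtain ⟨O, hO⟩ := exists_orthogonalGroup_toEuclideanLin_eq L
  refine ⟨O, Matrix.toEuclideanLin.injective (LinearMap.ext fun x => ?_)⟩
  rw [Matrix.toLpLin_mul_same, hO]
  exact hL x

theorem exists_eq_mul_of_forall_orthogonalGroup [Fintype κ] {A : Matrix d κ ℝ} {F : Matrix d ν ℝ}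
    (h : ∀ O : Matrix.orthogonalGroup d ℝ,
      (O : Matrix d d ℝ) * A = A → (O : Matrix d d ℝ) * F = F) :
    ∃ S : Matrix κ ν ℝ, F = A * S := by
  classical
  let W := LinearMap.range (Matrix.toEuclideanLin A)
  obtain ⟨O, hO⟩ := exists_orthogonalGroup_toEuclideanLin_eq W.reflection.toLinearIsometry
  have hfix : ∀ v : d → ℝ, (O : Matrix d d ℝ) *ᵥ v = v ↔ ∃ s, A *ᵥ s = v := fun v => by
    have happly : W.reflection (WithLp.toLp 2 v) = WithLp.toLp 2 ((O : Matrix d d ℝ) *ᵥ v) :=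
      (LinearMap.congr_fun hO (WithLp.toLp 2 v)).symm
    rw [← (WithLp.toLp_injective 2).eq_iff, ← happly, Submodule.reflection_eq_self_iff]
    exact ⟨fun ⟨s, hs⟩ => ⟨s.ofLp, congrArg WithLp.ofLp hs⟩,
      fun ⟨s, hs⟩ => ⟨WithLp.toLp 2 s, congrArg (WithLp.toLp 2) hs⟩⟩
  have hA : (O : Matrix d d ℝ) * A = A := by
    ext i j
    exact congrFun ((hfix (A.col j)).2 ⟨Pi.single j 1, Matrix.mulVec_single_one A j⟩) i
  choose s hs using fun j =>
    (hfix (F.col j)).1 (congrArg (fun M : Matrix d ν ℝ => M.col j) (h O hA))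
  exact ⟨Matrix.of fun i j => s j i, Matrix.ext fun i j => (congrFun (hs j) i).symm⟩

end OrthogonalMatrices

section FrobeniusNorm

attribute [local instance] Matrix.frobeniusNormedAddCommGroup Matrix.frobeniusNormedSpace

theorem continuous_frobeniusNorm {d l : ℕ} :
    Continuous (frobeniusNorm : Matrix (Fin d) (Fin l) ℝ → ℝ) := continuous_norm

@[simp]
theorem frobeniusNorm_zero {d l : ℕ} : frobeniusNorm (0 : Matrix (Fin d) (Fin l) ℝ) = 0 := norm_zero

theorem convex_setOf_frobeniusNorm_sub_lt {E : Type*} [AddCommGroup E] [Module ℝ E] {d l : ℕ}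
    (F : Matrix (Fin d) (Fin l) ℝ) (a : E →ₗ[ℝ] Matrix (Fin d) (Fin l) ℝ) (ε : ℝ) :
    Convex ℝ {v | frobeniusNorm (F - a v) < ε} := by
  have hball : {v | frobeniusNorm (F - a v) < ε} = a ⁻¹' Metric.ball F ε := by
    ext v
    rw [Set.mem_preimage, mem_ball_iff_norm']
    rfl
  exact hball ▸ (convex_ball F ε).linear_preimage a

end FrobeniusNorm

section Equivariance

variable {d κ ν ι X : Type*} [Fintype d]

/-- The entries of the Gram matrix of the columns of `A x`, concatenated with the scalars `u x`:
the vector that `MLP.matrixMap` passes to the perceptron. -/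
def gramInvariants (A : X → Matrix d κ ℝ) (u : X → ι → ℝ) (x : X) : (κ × κ) ⊕ ι → ℝ :=
  Sum.elim (fun q => ((A x)ᵀ * A x) q.1 q.2) (u x)

theorem gramInvariants_eq_iff {A : X → Matrix d κ ℝ} {u : X → ι → ℝ} {x y : X} :
    gramInvariants A u x = gramInvariants A u y ↔ (A x)ᵀ * A x = (A y)ᵀ * A y ∧ u x = u y := by
  simp [gramInvariants, funext_iff, ← Matrix.ext_iff]

theorem continuous_gramInvariants [TopologicalSpace X] {A : X → Matrix d κ ℝ} {u : X → ι → ℝ}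
    (hA : Continuous A) (hu : Continuous u) : Continuous (gramInvariants A u) := by
  refine continuous_pi fun q => ?_
  cases q with
  | inl q => exact (hA.matrix_transpose.matrix_mul hA).matrix_elem q.1 q.2
  | inr i => exact (continuous_apply i).comp hu

variable [DecidableEq d]

/-- Equivariance of `f` on `K`, for points `x` described by the columns of `A x` and the scalars
`u x`: whenever an orthogonal matrix `O` carries the columns at `x` to those at `y`, and the scalars
agree, it carries `f x` to `f y`. No group acts on `X`; the subgroup that fixes `g` is recovered by
making `g` one of the columns. -/
def IsOrthogonalEquivariantOn (A : X → Matrix d κ ℝ) (u : X → ι → ℝ) (f : X → Matrix d ν ℝ)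
    (K : Set X) : Prop :=
  ∀ x ∈ K, ∀ y ∈ K, ∀ O : Matrix.orthogonalGroup d ℝ,
    (O : Matrix d d ℝ) * A x = A y → u x = u y → f y = (O : Matrix d d ℝ) * f x

theorem isOrthogonalEquivariantOn_mul [Fintype κ] (A : X → Matrix d κ ℝ) (u : X → ι → ℝ)
    (σ : Matrix κ κ ℝ → (ι → ℝ) → Matrix κ ν ℝ) (K : Set X) :
    IsOrthogonalEquivariantOn A u (fun x => A x * σ ((A x)ᵀ * A x) (u x)) K := by
  intro x _ y _ O hO hu
  have hO1 : (O : Matrix d d ℝ)ᵀ * (O : Matrix d d ℝ) = 1 :=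
    (Matrix.mem_orthogonalGroup_iff' d ℝ).1 O.2
  have hgram : (A y)ᵀ * A y = (A x)ᵀ * A x := by
    rw [← hO, Matrix.transpose_mul, Matrix.mul_assoc, ← Matrix.mul_assoc _ (O : Matrix d d ℝ), hO1,
      Matrix.one_mul]
  simp only [hgram, ← hu]
  rw [← hO, Matrix.mul_assoc]

theorem IsOrthogonalEquivariantOn.exists_eq_mul [Fintype κ] {A : X → Matrix d κ ℝ} {u : X → ι → ℝ}
    {f : X → Matrix d ν ℝ} {K : Set X} (hf : IsOrthogonalEquivariantOn A u f K)
    (z : (κ × κ) ⊕ ι → ℝ) :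
    ∃ S : Matrix κ ν ℝ, ∀ x ∈ K, gramInvariants A u x = z → f x = A x * S := by
  by_cases hz : ∃ x ∈ K, gramInvariants A u x = z
  · obtain ⟨x, hx, rfl⟩ := hz
    obtain ⟨S, hS⟩ := exists_eq_mul_of_forall_orthogonalGroup fun O hO =>
      (hf x hx x hx O hO rfl).symm
    refine ⟨S, fun y hy hyx => ?_⟩
    obtain ⟨hgram, hu⟩ := gramInvariants_eq_iff.1 hyx.symm
    obtain ⟨O, hO⟩ := exists_orthogonalGroup_mul_eq_of_gram_eq hgram
    rw [hf x hx y hy O hO hu, hS, ← Matrix.mul_assoc, hO]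
  · exact ⟨0, fun x hx hxz => absurd ⟨x, hx, hxz⟩ hz⟩

end Equivariance

theorem IsOrthogonalEquivariantOn.exists_forall_frobeniusNorm_lt {d n m' : ℕ} {κ : Type}
    [Fintype κ] {X : Type*} [TopologicalSpace X] [CompactSpace X] {A : X → Matrix (Fin d) κ ℝ}
    {u : X → Fin n → ℝ} {f : X → Matrix (Fin d) (Fin m') ℝ}
    (hf : IsOrthogonalEquivariantOn A u f Set.univ) (hAc : Continuous A) (huc : Continuous u)
    (hfc : Continuous f) {ρ : ℝ → ℝ} (hc : Continuous ρ)
    (hρ : ¬ ∃ P : Polynomial ℝ, ∀ t : ℝ, ρ t = P.eval t) {ε : ℝ} (hε : 0 < ε) :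
    ∃ N : MLP (κ × Fin m') ((κ × κ) ⊕ Fin n), ∀ x,
      frobeniusNorm (f x - A x * N.matrixMap ρ ((A x)ᵀ * A x) (u x)) < ε := by
  let toMatrix : (κ × Fin m' → ℝ) ≃ₗ[ℝ] Matrix κ (Fin m') ℝ :=
    LinearEquiv.curry ℝ ℝ κ (Fin m') ≪≫ₗ Matrix.ofLinearEquiv ℝ
  have htoMatrix : Continuous toMatrix := toMatrix.toLinearMap.continuous_of_finiteDimensional
  refine MLP.exists_forall_mem_of_isOpen hc hρ (continuous_gramInvariants hAc huc)
    (U := {q | frobeniusNorm (f q.1 - A q.1 * toMatrix q.2) < ε}) ?_ ?_ ?_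
  · refine isOpen_lt (continuous_frobeniusNorm.comp ?_) continuous_const
    exact (hfc.comp continuous_fst).sub
      ((hAc.comp continuous_fst).matrix_mul (htoMatrix.comp continuous_snd))
  · exact fun x => convex_setOf_frobeniusNorm_sub_lt (f x)
      (mulLeftLinearMap _ ℝ (A x) ∘ₗ toMatrix.toLinearMap) ε
  · intro z
    obtain ⟨S, hS⟩ := hf.exists_eq_mul z
    refine ⟨toMatrix.symm S, fun x hx => ?_⟩
    simpa [hS x trivial hx] using hε

theorem theorem1_general {d n m' : ℕ} {κ : Type} [Fintype κ] {X : Type*} [TopologicalSpace X]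
    (A : X → Matrix (Fin d) κ ℝ) (u : X → Fin n → ℝ) :
    (∀ σ : Matrix κ κ ℝ → (Fin n → ℝ) → Matrix κ (Fin m') ℝ,
      IsOrthogonalEquivariantOn A u (fun x => A x * σ ((A x)ᵀ * A x) (u x)) Set.univ) ∧
    (∀ ρ : ℝ → ℝ, Continuous ρ → (¬ ∃ P : Polynomial ℝ, ∀ t : ℝ, ρ t = P.eval t) →
      ∀ (f : X → Matrix (Fin d) (Fin m') ℝ) (K : Set X), IsOrthogonalEquivariantOn A u f K →
        IsCompact K → ContinuousOn A K → ContinuousOn u K → ContinuousOn f K →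
          ∀ ε : ℝ, 0 < ε →
            ∃ N : MLP (κ × Fin m') ((κ × κ) ⊕ Fin n), ∀ x ∈ K,
              frobeniusNorm (f x - A x * N.matrixMap ρ ((A x)ᵀ * A x) (u x)) < ε) := by
  refine ⟨fun σ => isOrthogonalEquivariantOn_mul A u σ Set.univ, ?_⟩
  intro ρ hc hρ f K hf hK hAc huc hfc ε hε
  have : CompactSpace K := isCompact_iff_compactSpace.1 hK
  have hfK : IsOrthogonalEquivariantOn (K.domRestrict A) (K.domRestrict u) (K.domRestrict f)
      Set.univ :=
    fun x _ y _ => hf x x.2 y y.2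
  obtain ⟨N, hN⟩ := hfK.exists_forall_frobeniusNorm_lt hAc.domRestrict huc.domRestrict
    hfc.domRestrict hc hρ hε
  exact ⟨N, fun x hx => hN ⟨x, hx⟩⟩

section Subequivariance

variable {m n m' : ℕ} {g : Fin 3 → ℝ}

theorem continuous_augment : Continuous (augment g : Matrix (Fin 3) (Fin m) ℝ → _) := by
  refine continuous_matrix fun i j => ?_
  cases j with
  | inl j => exact continuous_id.matrix_elem i j
  | inr j => exact continuous_const

theorem mul_augment_eq_augment_iff {O : Matrix.orthogonalGroup (Fin 3) ℝ}
    {Z Z' : Matrix (Fin 3) (Fin m) ℝ} :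
    (O : Matrix (Fin 3) (Fin 3) ℝ) * augment g Z = augment g Z'
      ↔ O ∈ gravityGroup g ∧ (O : Matrix (Fin 3) (Fin 3) ℝ) * Z = Z' := by
  rw [augment, augment, Matrix.mul_fromCols, Matrix.fromCols_ext_iff,
    ← Matrix.replicateCol_mulVec, Matrix.replicateCol_inj, and_comm]
  rfl

theorem isSubequivariant_iff
    {f : Matrix (Fin 3) (Fin m) ℝ × (Fin n → ℝ) → Matrix (Fin 3) (Fin m') ℝ} :
    IsSubequivariant g f
      ↔ IsOrthogonalEquivariantOn (fun p => augment g p.1) Prod.snd f Set.univ := by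
  simp only [IsOrthogonalEquivariantOn, mul_augment_eq_augment_iff]
  refine ⟨?_, fun h O hO Z v => h (Z, v) trivial (_, v) trivial O ⟨hO, rfl⟩ rfl⟩
  rintro h ⟨Z, v⟩ - ⟨_, _⟩ - O ⟨hO, rfl⟩ rfl
  exact h O hO Z v

end Subequivariance

theorem theorem1 (m n m' : ℕ) (g : Fin 3 → ℝ) :
    (∀ σ : Matrix (Fin m ⊕ Unit) (Fin m ⊕ Unit) ℝ → (Fin n → ℝ) →
        Matrix (Fin m ⊕ Unit) (Fin m') ℝ,
      IsSubequivariant g (subequivariantMap g σ)) ∧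
    (∀ ρ : ℝ → ℝ, Continuous ρ → (¬ ∃ P : Polynomial ℝ, ∀ t : ℝ, ρ t = P.eval t) →
      ∀ f : Matrix (Fin 3) (Fin m) ℝ × (Fin n → ℝ) → Matrix (Fin 3) (Fin m') ℝ,
        IsSubequivariant g f →
        ∀ K : Set (Matrix (Fin 3) (Fin m) ℝ × (Fin n → ℝ)), IsCompact K → ContinuousOn f K →
          ∀ ε : ℝ, 0 < ε →
            ∃ N : MLP ((Fin m ⊕ Unit) × Fin m') (((Fin m ⊕ Unit) × (Fin m ⊕ Unit)) ⊕ Fin n),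
              ∀ p ∈ K,
                frobeniusNorm (f p - subequivariantMap g (N.matrixMap ρ) p) < ε) := by
  obtain ⟨ha, hb⟩ := theorem1_general (m' := m')
    (fun p : Matrix (Fin 3) (Fin m) ℝ × (Fin n → ℝ) => augment g p.1) Prod.snd
  exact ⟨fun σ => isSubequivariant_iff.2 (ha σ), fun ρ hc hρ f hf K hK hfK => hb ρ hc hρ f K
    (fun p _ q _ => isSubequivariant_iff.1 hf p trivial q trivial) hK
    (continuous_augment.comp continuous_fst).continuousOn continuous_snd.continuousOn hfK⟩
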